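/- Let $\mathbb K\in\{\mathbb R,\mathbb C\}$. A norming dual pair $(X,Y)$ over $\mathbb K$ consists of two non-trivial $\mathbb K$-Banach spaces and a $\mathbb K$-bilinear map $\langle\cdot,\cdot\rangle\colon X\times Y\to\mathbb K$ such that $\|x\|=\sup\{|\langle x,y\rangle| : \|y\|\le 1\}$ for all $x\in X$ and $\|y\|=\sup\{|\langle x,y\rangle| : \|x\|\le 1\}$ for all $y\in Y$. Write $\sigma(X,Y)$ for the topology on $X$ of pointwise convergence on $Y$, and $\sigma(Y,Y^*)$ for the weak topology of $Y$, where $Y^*$ is the norm dual of $Y$. A complex Banach lattice is the complexification of a real Banach lattice, with modulus $|z|=\sup_{\theta}\operatorname{Re}(e^{i\theta}z)$ and norm $\|z\|=\|\,|z|\,\|$. Let $(X,Y)$ be a norming dual pair over $\mathbb K$ such that - $X$ and $Y$ are Banach lattices over $\mathbb K$ and the pairing is compatible with the orders, i.e. $\langle x,y\rangle\ge 0$ for all $x\in X_+$ and $y\in Y_+$; - the lattice operations of $X$ are sequentially $\sigma(X,Y)$-continuous, i.e. for every sequence $(x_n)$ in $X$ with $x_n\to 0$ with respect to $\sigma(X,Y)$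 one has $|x_n|\to 0$ with respect to $\sigma(X,Y)$; - $Y$ is an AL-space, i.e. $\|y_1+y_2\|=\|y_1\|+\|y_2\|$ for all $y_1,y_2\in Y_+$. Then $X$ has the Dunford–Pettis property with respect to $Y$: for every sequence $(x_n)$ in $X$ converging to $0$ with respect to $\sigma(X,Y)$ and every sequence $(y_n)$ in $Y$ converging to $0$ with respect to $\sigma(Y,Y^*)$, one has $\langle x_n,y_n\rangle\to 0$ as $n\to\infty$. -/

import Mathlib

open Filter Topology

/-- `X` is a Banach lattice over `𝕜` (`ℝ` or `ℂ`) with real part the real Banach lattice `E`: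
every `x : X` has the form `a + i b` with `a`, `b` in `E`, the modulus of `a + i b` is the supremum
in `E` of the elements `Re (c (a + i b))`, `|c| = 1`, and `‖x‖ = ‖|x|‖`.

For `𝕜 = ℂ` this says that `X` is the complexification of `E` with its usual norm: the
decomposition is then automatically unique, as `modulus 0 = 0`.
For `𝕜 = ℝ` one has `RCLike.I = 0` and `c = ±1`, so `ofReal` is an isometric isomorphism of `E`
onto `X`, and `modulus (ofReal a) = a ⊔ -a` is the usual absolute value.
The supremum determines `modulus`; it exists in every real Banach lattice. -/
structure BanachLatticeStructure (𝕜 : Type*) [RCLike 𝕜]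
    (E : Type*) [NormedAddCommGroup E] [Lattice E] [HasSolidNorm E] [IsOrderedAddMonoid E]
    [NormedSpace ℝ E] [IsOrderedModule ℝ E] [CompleteSpace E]
    (X : Type*) [NormedAddCommGroup X] [NormedSpace 𝕜 X] [CompleteSpace X] where
  /-- The inclusion of the real part. -/
  ofReal : E →ₛₗ[algebraMap ℝ 𝕜] X
  /-- The modulus `|x|`, an element of the real part. -/
  modulus : X → E
  exists_eq : ∀ x : X, ∃ a b : E, x = ofReal a + (RCLike.I : 𝕜) • ofReal b
  isLUB_modulus : ∀ a b : E,
    IsLUB {e : E | ∃ c : 𝕜, ‖c‖ = 1 ∧ e = RCLike.re c • a - RCLike.im c • b}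
      (modulus (ofReal a + (RCLike.I : 𝕜) • ofReal b))
  norm_modulus : ∀ x : X, ‖modulus x‖ = ‖x‖

/-- The norm of the lattice `F` is additive on the positive cone. A Banach lattice with real part
`F` is an AL-space if and only if this holds. -/
def NormAdditiveOnCone (F : Type*) [NormedAddCommGroup F] [Lattice F] : Prop :=
  ∀ a b : F, 0 ≤ a → 0 ≤ b → ‖a + b‖ = ‖a‖ + ‖b‖

section Pairing

variable {𝕜 : Type*} [RCLike 𝕜]
  {X : Type*} [NormedAddCommGroup X] [NormedSpace 𝕜 X]
  {Y : Type*} [NormedAddCommGroup Y] [NormedSpace 𝕜 Y]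

/-- The bilinear map `B` makes the Banach spaces `X`, `Y` a norming dual pair. -/
structure IsNormingDualPair [CompleteSpace X] [CompleteSpace Y] (B : X →ₗ[𝕜] Y →ₗ[𝕜] 𝕜) :
    Prop where
  nontrivial_left : Nontrivial X
  nontrivial_right : Nontrivial Y
  norm_left : ∀ x : X, IsLUB {r : ℝ | ∃ y : Y, ‖y‖ ≤ 1 ∧ r = ‖B x y‖} ‖x‖
  norm_right : ∀ y : Y, IsLUB {r : ℝ | ∃ x : X, ‖x‖ ≤ 1 ∧ r = ‖B x y‖} ‖y‖

/-- The sequence `x` converges to `0` in the topology `σ(X, Y)` given by the pairing `B`. -/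
def TendstoZeroSigma (B : X →ₗ[𝕜] Y →ₗ[𝕜] 𝕜) (x : ℕ → X) : Prop :=
  Tendsto (β := WeakBilin B) x atTop (𝓝 (0 : WeakBilin B))

/-- `X` has the Dunford–Pettis property with respect to `Y`: one has `⟨x n, y n⟩ → 0` whenever
`x n → 0` in `σ(X, Y)` and `y n → 0` in `σ(Y, Y*)`, where `Y*` is the norm dual of `Y`. -/
def HasDunfordPettisProperty (B : X →ₗ[𝕜] Y →ₗ[𝕜] 𝕜) : Prop :=
  ∀ (x : ℕ → X) (y : ℕ → Y), TendstoZeroSigma B x →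
    Tendsto (fun n => toWeakSpace 𝕜 Y (y n)) atTop (𝓝 0) →
      Tendsto (fun n => B (x n) (y n)) atTop (𝓝 0)

end Pairing

section LatticePairing

variable {𝕜 : Type*} [RCLike 𝕜]
  {E : Type*} [NormedAddCommGroup E] [Lattice E] [HasSolidNorm E] [IsOrderedAddMonoid E]
  [NormedSpace ℝ E] [IsOrderedModule ℝ E] [CompleteSpace E]
  {X : Type*} [NormedAddCommGroup X] [NormedSpace 𝕜 X] [CompleteSpace X]
  {F : Type*} [NormedAddCommGroup F] [Lattice F] [HasSolidNorm F] [IsOrderedAddMonoid F]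
  [NormedSpace ℝ F] [IsOrderedModule ℝ F] [CompleteSpace F]
  {Y : Type*} [NormedAddCommGroup Y] [NormedSpace 𝕜 Y] [CompleteSpace Y]

/-- The lattice operations of the Banach lattice `X` are sequentially `σ(X, Y)`-continuous:
if `x n → 0` in `σ(X, Y)`, then `|x n| → 0` in `σ(X, Y)`. -/
def SeqSigmaContinuousLatticeOps (L : BanachLatticeStructure 𝕜 E X)
    (B : X →ₗ[𝕜] Y →ₗ[𝕜] 𝕜) : Prop :=
  ∀ x : ℕ → X, TendstoZeroSigma B x →
    TendstoZeroSigma B (fun n => L.ofReal (L.modulus (x n)))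

/-- The pairing is compatible with the orders of the Banach lattices `X` and `Y`: `⟨x, y⟩` is a
nonnegative real number for all positive `x` and `y`. -/
def IsPositivePairing (L : BanachLatticeStructure 𝕜 E X) (M : BanachLatticeStructure 𝕜 F Y)
    (B : X →ₗ[𝕜] Y →ₗ[𝕜] 𝕜) : Prop :=
  ∀ (a : E) (b : F), 0 ≤ a → 0 ≤ b → ∃ r : ℝ, 0 ≤ r ∧ B (L.ofReal a) (M.ofReal b) = (r : 𝕜)

end LatticePairing

/-! ### Disjointness in lattice-ordered groups -/

section LatticeGroup

variable {F : Type*} [AddCommGroup F] [Lattice F] [IsOrderedAddMonoid F]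

/-! In an AL-space a weakly null sequence `b` is almost order bounded: for each ε > 0 some u ≥ 0 has
‖((b n)⁺ - u)⁺‖ ≤ ε for all n (`NormAdditiveOnCone.exists_norm_posPart_sub_le`). Hence |⟨x n, (b
n)⁺⟩| ≤ ⟨|x n|, u⟩ + ε ‖x n‖; the first term tends to 0 because the lattice operations are
continuous, and `x` is bounded by Banach–Steinhaus. Negative and imaginary parts reduce to this
case.

If almost order boundedness failed, `exists_disjoint_seq` would give disjoint z k, with norms
bounded below, under a subsequence of the (b n)⁺. The norm of the component in the band of z k is
additive on the cone (`bandNorm_add`), and summing over any set of indices k still gives a bounded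
functional (`sum_bandNorm_le`). All these functionals tend to 0 along the subsequence, which
contradicts the gliding hump `exists_set_not_tendsto_tsum`. -/

theorem add_inf_le_inf_add_inf {x y z : F} (hx : 0 ≤ x) (hy : 0 ≤ y) (hz : 0 ≤ z) :
    (x + y) ⊓ z ≤ x ⊓ z + y ⊓ z := by
  rw [inf_add, add_inf]
  refine le_inf (le_inf inf_le_left ?_) ?_
  · exact inf_le_right.trans (le_add_of_nonneg_left hx)
  · exact inf_le_right.trans (le_add_of_nonneg_right (le_inf hy hz))

theorem inf_add_inf_le_add_inf_add (x y z w : F) : x ⊓ z + y ⊓ w ≤ (x + y) ⊓ (z + w) :=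
  le_inf (add_le_add inf_le_left inf_le_left) (add_le_add inf_le_right inf_le_right)

theorem nsmul_inf_eq_zero {x y : F} (hx : 0 ≤ x) (hy : 0 ≤ y) (h : x ⊓ y = 0) (n : ℕ) :
    (n • x) ⊓ y = 0 := by
  induction n with
  | zero => simpa using hy
  | succ n ih =>
    refine le_antisymm ?_ (le_inf (nsmul_nonneg hx _) hy)
    rw [succ_nsmul]
    simpa [ih, h] using add_inf_le_inf_add_inf (nsmul_nonneg hx n) hx hy

theorem nsmul_inf_nsmul_eq_zero {x y : F} (hx : 0 ≤ x) (hy : 0 ≤ y) (h : x ⊓ y = 0) (m n : ℕ) :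
    (m • x) ⊓ (n • y) = 0 := by
  have h1 := nsmul_inf_eq_zero hx hy h m
  rw [inf_comm] at h1 ⊢
  exact nsmul_inf_eq_zero hy (nsmul_nonneg hx m) h1 n

theorem sum_inf_eq_zero {ι : Type*} (s : Finset ι) {x : ι → F} {y : F} (hx : ∀ i, 0 ≤ x i)
    (hy : 0 ≤ y) (h : ∀ i ∈ s, x i ⊓ y = 0) : (∑ i ∈ s, x i) ⊓ y = 0 := by
  classical
  induction s using Finset.induction_on with
  | empty => simpa using hy
  | insert i s hi ih =>
    refine le_antisymm ?_ (le_inf (Finset.sum_nonneg fun i _ => hx i) hy)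
    rw [Finset.sum_insert hi]
    refine (add_inf_le_inf_add_inf (hx i) (Finset.sum_nonneg fun i _ => hx i) hy).trans ?_
    rw [h i (by simp), ih fun j hj => h j (by simp [hj]), add_zero]

/-- For disjoint elements the sum is the supremum, since a + b = a ⊓ b + a ⊔ b. -/
theorem sum_le_of_disjoint {ι : Type*} (s : Finset ι) {x : ι → F} {y : F} (hx : ∀ i, 0 ≤ x i)
    (hy : 0 ≤ y) (h : Pairwise fun i j => x i ⊓ x j = 0) (hxy : ∀ i, x i ≤ y) :
    ∑ i ∈ s, x i ≤ y := by
  classical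
  induction s using Finset.induction_on with
  | empty => simpa using hy
  | insert i s hi ih =>
    rw [Finset.sum_insert hi, ← inf_add_sup, inf_comm, sum_inf_eq_zero s hx (hx i), zero_add]
    · exact sup_le (hxy i) ih
    · exact fun j hj => h fun e => hi (e ▸ hj)

theorem posPart_inf_posPart_neg (x : F) : x⁺ ⊓ (-x)⁺ = 0 := by
  rw [posPart_neg]; exact posPart_inf_negPart_eq_zero x

end LatticeGroup

/-! ### Band functionals on AL-spaces -/

section ALSpace

variable {F : Type*} [NormedAddCommGroup F] [Lattice F]

/-- The norm of the component of `y ≥ 0` in the band generated by `u ≥ 0`. -/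
noncomputable def bandNorm (u y : F) : ℝ := ⨆ n : ℕ, ‖y ⊓ n • u‖

theorem bandNorm_nonneg (u y : F) : 0 ≤ bandNorm u y :=
  Real.iSup_nonneg fun _ => norm_nonneg _

theorem NormAdditiveOnCone.norm_sum [IsOrderedAddMonoid F]
    (hF : NormAdditiveOnCone F) {ι : Type*} (s : Finset ι) {x : ι → F} (hx : ∀ i, 0 ≤ x i) :
    ‖∑ i ∈ s, x i‖ = ∑ i ∈ s, ‖x i‖ := by
  classical
  induction s using Finset.induction_on with
  | empty => simp
  | insert i s hi ih =>
    rw [Finset.sum_insert hi, Finset.sum_insert hi,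
      hF _ _ (hx i) (Finset.sum_nonneg fun i _ => hx i), ih]

variable {u y z : F}

theorem inf_nsmul_nonneg [IsOrderedAddMonoid F] (hu : 0 ≤ u) (hy : 0 ≤ y) (n : ℕ) :
    0 ≤ y ⊓ n • u :=
  le_inf hy (nsmul_nonneg hu n)

theorem bandNorm_eq_zero [IsOrderedAddMonoid F] (hu : 0 ≤ u) (hy : 0 ≤ y)
    (h : u ⊓ y = 0) : bandNorm u y = 0 := by
  have : ∀ n : ℕ, y ⊓ n • u = 0 := fun n => by
    rw [inf_comm]; exact nsmul_inf_eq_zero hu hy h n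
  simp [bandNorm, this]

variable [HasSolidNorm F] [IsOrderedAddMonoid F]

theorem norm_mono_of_nonneg {x y : F} (hx : 0 ≤ x) (h : x ≤ y) : ‖x‖ ≤ ‖y‖ := by
  apply norm_le_norm_of_abs_le_abs
  rwa [abs_of_nonneg hx, abs_of_nonneg (hx.trans h)]

theorem norm_inf_nsmul_le (hu : 0 ≤ u) (hy : 0 ≤ y) (n : ℕ) : ‖y ⊓ n • u‖ ≤ ‖y‖ :=
  norm_mono_of_nonneg (inf_nsmul_nonneg hu hy n) inf_le_left

theorem tendsto_bandNorm (hu : 0 ≤ u) (hy : 0 ≤ y) :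
    Tendsto (fun n : ℕ => ‖y ⊓ n • u‖) atTop (𝓝 (bandNorm u y)) := by
  refine tendsto_atTop_ciSup (fun m n h => ?_) ⟨‖y‖, ?_⟩
  · exact norm_mono_of_nonneg (inf_nsmul_nonneg hu hy m)
      (inf_le_inf_left _ (nsmul_le_nsmul_left hu h))
  · rintro _ ⟨n, rfl⟩
    exact norm_inf_nsmul_le hu hy n

/-- Truncation at n • u is subadditive, which gives ≤. For ≥, the two truncations at n • u add up to
at most the truncation of y + z at 2n • u, and the norm is additive on the cone. -/
theorem bandNorm_add (hF : NormAdditiveOnCone F) (hu : 0 ≤ u) (hy : 0 ≤ y) (hz : 0 ≤ z) :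
    bandNorm u (y + z) = bandNorm u y + bandNorm u z := by
  have h := tendsto_bandNorm hu (add_nonneg hy hz)
  have h2 := (tendsto_bandNorm hu hy).add (tendsto_bandNorm hu hz)
  refine le_antisymm (le_of_tendsto_of_tendsto' h h2 fun n => ?_)
    (le_of_tendsto_of_tendsto' h2
      (h.comp (tendsto_atTop_mono (fun n => Nat.le_add_left n n) tendsto_id)) fun n => ?_)
  · refine (norm_mono_of_nonneg (inf_nsmul_nonneg hu (add_nonneg hy hz) n)
      (add_inf_le_inf_add_inf hy hz (nsmul_nonneg hu n))).trans (norm_add_le _ _)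
  · rw [← hF _ _ (inf_nsmul_nonneg hu hy n) (inf_nsmul_nonneg hu hz n)]
    refine norm_mono_of_nonneg
      (add_nonneg (inf_nsmul_nonneg hu hy n) (inf_nsmul_nonneg hu hz n)) ?_
    simpa [add_nsmul] using inf_add_inf_le_add_inf_add y z (n • u) (n • u)

theorem norm_le_bandNorm (hu : 0 ≤ u) (h : u ≤ y) : ‖u‖ ≤ bandNorm u y := by
  refine le_of_tendsto_of_tendsto tendsto_const_nhds (tendsto_bandNorm hu (hu.trans h)) ?_
  filter_upwards [eventually_ge_atTop 1] with n hn
  refine norm_mono_of_nonneg hu (le_inf h ?_)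
  simpa using nsmul_le_nsmul_left hu hn

/-- The truncations y ⊓ n • u i are disjoint and below y, so their sum is below y; additivity of the
norm and the limit in n finish. -/
theorem sum_bandNorm_le (hF : NormAdditiveOnCone F) {ι : Type*} (s : Finset ι) {u : ι → F}
    (hu : ∀ i, 0 ≤ u i) (hd : Pairwise fun i j => u i ⊓ u j = 0) (hy : 0 ≤ y) :
    ∑ i ∈ s, bandNorm (u i) y ≤ ‖y‖ := by
  refine le_of_tendsto' (tendsto_finsetSum s fun i _ => tendsto_bandNorm (hu i) hy) fun n => ?_
  have h0 : ∀ i, 0 ≤ y ⊓ n • u i := fun i => inf_nsmul_nonneg (hu i) hy n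
  rw [← hF.norm_sum s h0]
  refine norm_mono_of_nonneg (Finset.sum_nonneg fun i _ => h0 i)
    (sum_le_of_disjoint s h0 hy (fun i j hij => ?_) fun i => inf_le_left)
  refine le_antisymm ?_ (le_inf (h0 i) (h0 j))
  rw [← nsmul_inf_nsmul_eq_zero (hu i) (hu j) (hd hij) n n]
  exact inf_le_inf inf_le_right inf_le_right

theorem summable_bandNorm (hF : NormAdditiveOnCone F) {ι : Type*} {u : ι → F}
    (hu : ∀ i, 0 ≤ u i) (hd : Pairwise fun i j => u i ⊓ u j = 0) (hy : 0 ≤ y) :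
    Summable fun i => bandNorm (u i) y :=
  summable_of_sum_le (fun _ => bandNorm_nonneg _ _) fun s => sum_bandNorm_le hF s hu hd hy

/-- An additive function on the positive cone that is dominated by the norm extends to a continuous
linear functional. -/
theorem exists_extend_of_additiveOnCone [NormedSpace ℝ F] (ψ : F → ℝ)
    (hadd : ∀ x y, 0 ≤ x → 0 ≤ y → ψ (x + y) = ψ x + ψ y) (h0 : ∀ x, 0 ≤ x → 0 ≤ ψ x)
    (hle : ∀ x, 0 ≤ x → ψ x ≤ ‖x‖) : ∃ φ : F →L[ℝ] ℝ, ∀ x, φ x = ψ x⁺ - ψ x⁻ := by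
  let f : F →+ ℝ := AddMonoidHom.mk' (fun x => ψ x⁺ - ψ x⁻) fun x y => by
    -- Arranged so that both sides are sums of positive elements, where ψ is additive.
    have h : (x + y)⁺ + (x⁻ + y⁻) = (x + y)⁻ + (x⁺ + y⁺) := by
      have h1 := posPart_sub_negPart (x + y)
      have h2 := posPart_sub_negPart x
      have h3 := posPart_sub_negPart y
      calc (x + y)⁺ + (x⁻ + y⁻) = ((x + y)⁺ - (x + y)⁻) + (x + y)⁻ + (x⁻ + y⁻) := by abel
        _ = ((x⁺ - x⁻) + (y⁺ - y⁻)) + (x + y)⁻ + (x⁻ + y⁻) := by rw [h1, h2, h3]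
        _ = _ := by abel
    have := congrArg ψ h
    rw [hadd _ _ (posPart_nonneg _) (add_nonneg (negPart_nonneg _) (negPart_nonneg _)),
      hadd _ _ (negPart_nonneg _) (negPart_nonneg _),
      hadd _ _ (negPart_nonneg _) (add_nonneg (posPart_nonneg _) (posPart_nonneg _)),
      hadd _ _ (posPart_nonneg _) (posPart_nonneg _)] at this
    linarith
  have hf : Continuous f := by
    refine AddMonoidHomClass.continuous_of_bound f 1 fun x => ?_
    have hp : ‖x⁺‖ ≤ ‖x‖ := norm_le_norm_of_abs_le_abs <| by
      rw [abs_of_nonneg (posPart_nonneg x)]; exact sup_le (le_abs_self x) (abs_nonneg x)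
    have hn : ‖x⁻‖ ≤ ‖x‖ := norm_le_norm_of_abs_le_abs <| by
      rw [abs_of_nonneg (negPart_nonneg x)]; exact sup_le (neg_le_abs x) (abs_nonneg x)
    have := h0 _ (posPart_nonneg x)
    have := h0 _ (negPart_nonneg x)
    have := hle _ (posPart_nonneg x)
    have := hle _ (negPart_nonneg x)
    change |ψ x⁺ - ψ x⁻| ≤ 1 * ‖x‖
    rw [abs_le]
    constructor <;> linarith
  exact ⟨f.toRealLinearMap hf, fun x => rfl⟩

end ALSpace

/-- Gliding hump: a matrix with absolutely summable columns and with row entries tending to `0`,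
whose diagonal is bounded away from `0`, has a set of rows whose sum does not tend to `0`. -/
theorem exists_set_not_tendsto_tsum {a : ℕ → ℕ → ℝ} {δ : ℝ} (hδ : 0 < δ)
    (hs : ∀ n, Summable fun k => a k n) (h0 : ∀ k, Tendsto (a k) atTop (𝓝 0))
    (hd : ∀ k, δ ≤ |a k k|) :
    ∃ S : Set ℕ, ¬ Tendsto (fun n => ∑' k, S.indicator (fun k => a k n) k) atTop (𝓝 0) := by
  have hδ4 : 0 < δ / 4 := by positivity
  -- Beyond N, rows up to m have small entries, and rows from N on contribute little to column m.
  have key : ∀ m, ∃ N, m < N ∧ (∀ n ≥ N, ∑ k ∈ Finset.range (m + 1), |a k n| < δ / 4) ∧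
      ∀ S : Set ℕ, (∀ k ∈ S, N ≤ k) → |∑' k, S.indicator (fun k => a k m) k| < δ / 4 := by
    intro m
    have h1 : Tendsto (fun n => ∑ k ∈ Finset.range (m + 1), |a k n|) atTop (𝓝 0) := by
      simpa using tendsto_finsetSum (Finset.range (m + 1)) fun k _ => (h0 k).abs
    obtain ⟨N₁, hN₁⟩ := eventually_atTop.1 (h1.eventually (gt_mem_nhds hδ4))
    obtain ⟨s, hs'⟩ := (hs m).vanishing (Metric.ball_mem_nhds (0 : ℝ) (half_pos hδ4))
    obtain ⟨N₂, hN₂⟩ := s.exists_nat_subset_range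
    refine ⟨max (m + 1) (max N₁ N₂), by simp, fun n hn => hN₁ n (by simp at hn; omega), ?_⟩
    intro S hS
    have hsum := (hs m).indicator S
    have : |∑' k, S.indicator (fun k => a k m) k| ≤ δ / 4 / 2 := by
      refine le_of_tendsto hsum.hasSum.abs (Eventually.of_forall fun t => ?_)
      classical
      rw [Finset.sum_indicator_eq_sum_filter]
      have := hs' (t.filter fun k => k ∈ S) (by
        rw [Finset.disjoint_left]
        intro k hk hks
        have h3 := hS k (Finset.mem_filter.1 hk).2
        have h4 := Finset.mem_range.1 (hN₂ hks)
        simp at h3; omega)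
      rw [mem_ball_zero_iff, Real.norm_eq_abs] at this
      exact this.le
    linarith
  choose f hf hf1 hf2 using key
  -- In column s (i + 1) the chosen rows before and after the diagonal each contribute less than δ /
  -- 4, the diagonal at least δ.
  set s : ℕ → ℕ := fun i => f^[i] 0 with hsdef
  have hss : ∀ i, s (i + 1) = f (s i) := fun i => Function.iterate_succ_apply' f i 0
  have hmono : StrictMono s := strictMono_nat_of_lt_succ fun i => by rw [hss]; exact hf _
  refine ⟨Set.range s, fun hT => ?_⟩
  have hT' := (hT.comp hmono.tendsto_atTop).comp (tendsto_add_atTop_nat 1)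
  obtain ⟨i, hi⟩ :=
    (hT'.abs.eventually (gt_mem_nhds (by simpa using hδ4 : |(0 : ℝ)| < δ / 4))).exists
  simp only [Function.comp_apply] at hi
  set n := s (i + 1) with hn
  have e1 : Set.range s = (s '' Set.Iic i ∪ {n}) ∪ s '' Set.Ioi (i + 1) := by
    ext k
    constructor
    · rintro ⟨j, rfl⟩
      rcases lt_trichotomy j (i + 1) with h | h | h
      · exact Or.inl (Or.inl ⟨j, Nat.lt_succ_iff.1 h, rfl⟩)
      · exact Or.inl (Or.inr (by rw [h]; rfl))
      · exact Or.inr ⟨j, h, rfl⟩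
    · rintro ((⟨j, -, rfl⟩ | rfl) | ⟨j, -, rfl⟩) <;> exact ⟨_, rfl⟩
  have d1 : Disjoint (s '' Set.Iic i ∪ {n}) (s '' Set.Ioi (i + 1)) := by
    rw [Set.disjoint_left]
    rintro k (⟨j, hj, rfl⟩ | rfl) ⟨l, hl, he⟩
    · have := hmono.injective he
      simp only [Set.mem_Iic, Set.mem_Ioi] at hj hl; omega
    · have := hmono.injective he
      simp only [Set.mem_Ioi] at hl; omega
  have d2 : Disjoint (s '' Set.Iic i) {n} := by
    rw [Set.disjoint_left]
    rintro k ⟨j, hj, rfl⟩ he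
    have := hmono.injective he
    simp only [Set.mem_Iic] at hj; omega
  rw [e1, Set.indicator_union_of_disjoint d1, Set.indicator_union_of_disjoint d2] at hi
  have su := fun T : Set ℕ => (hs n).indicator T
  have t2 := hf2 n (s '' Set.Ioi (i + 1)) (by
    rintro _ ⟨j, hj, rfl⟩
    rw [hn, ← hss]
    exact hmono.monotone hj)
  have t1 : |∑' k, (s '' Set.Iic i).indicator (fun k => a k n) k| < δ / 4 := by
    refine lt_of_le_of_lt ?_ (hf1 (s i) n (hss i).ge)
    rw [tsum_eq_sum (s := Finset.range (s i + 1))]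
    · refine (Finset.abs_sum_le_sum_abs _ _).trans (Finset.sum_le_sum fun k _ => ?_)
      by_cases hk : k ∈ s '' Set.Iic i
      · rw [Set.indicator_of_mem hk]
      · rw [Set.indicator_of_notMem hk]; simp
    · intro k hk
      refine Set.indicator_of_notMem ?_ _
      rintro ⟨j, hj, rfl⟩
      exact hk (Finset.mem_range.2 (Nat.lt_succ_iff.2 (hmono.monotone hj)))
  have t3 : ∑' k, ({n} : Set ℕ).indicator (fun k => a k n) k = a n n := by
    rw [tsum_eq_single n fun k hk => Set.indicator_of_notMem (by simpa using hk) _]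
    simp
  rw [((su _).add (su _)).tsum_add (su _), (su _).tsum_add (su _), t3] at hi
  have := hd n
  rw [abs_lt] at hi t1 t2
  rcases le_abs.1 this with h | h <;> linarith

/-! ### Almost order boundedness of weakly null sequences -/

section AlmostOrderBounded

variable {F : Type*} [NormedAddCommGroup F] [Lattice F] [HasSolidNorm F] [IsOrderedAddMonoid F]
  [NormedSpace ℝ F] [IsOrderedModule ℝ F] [CompleteSpace F]

/-- A bounded positive sequence that is not almost order bounded dominates, along a subsequence,
a disjoint sequence whose norms are bounded away from `0`. -/
theorem exists_disjoint_seq {w : ℕ → F} (hw : ∀ n, 0 ≤ w n) {C : ℝ} (hC : ∀ n, ‖w n‖ ≤ C) {ε : ℝ}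
    (hε : 0 < ε) (h : ∀ u, 0 ≤ u → ∃ n, ε < ‖(w n - u)⁺‖) :
    ∃ (N : ℕ → ℕ) (z : ℕ → F), StrictMono N ∧ (∀ k, 0 ≤ z k) ∧ (∀ k, z k ≤ w (N k)) ∧
      (Pairwise fun i j => z i ⊓ z j = 0) ∧ ∀ k, ε / 2 ≤ ‖z k‖ := by
  have h' : ∀ u, ∃ n, 0 ≤ u → ε < ‖(w n - u)⁺‖ := fun u => by
    by_cases hu : 0 ≤ u
    · obtain ⟨n, hn⟩ := h u hu
      exact ⟨n, fun _ => hn⟩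
    · exact ⟨0, fun h => absurd h hu⟩
  choose g hg using h'
  set A : ℕ → ℕ → F := fun k m => (4 : ℝ) ^ k • ∑ i ∈ Finset.range (m + 1), w i with hA
  have hA0 : ∀ k m, 0 ≤ A k m := fun k m =>
    smul_nonneg (by positivity) (Finset.sum_nonneg fun i _ => hw i)
  have hwA : ∀ k m i, i ≤ m → (4 : ℝ) ^ k • w i ≤ A k m := fun k m i hi =>
    smul_le_smul_of_nonneg_left
      (Finset.single_le_sum (fun i _ => hw i) (Finset.mem_range.2 (Nat.lt_succ_iff.2 hi)))
      (by positivity)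
  -- The next index is a term not nearly dominated by 4 ^ k times the sum of all terms up to the
  -- current one.
  let M : ℕ → ℕ := fun k => Nat.rec 0 (fun k m => g (A k m)) k
  have hM : ∀ k, M (k + 1) = g (A k (M k)) := fun k => rfl
  have hMε : ∀ k, ε < ‖(w (M (k + 1)) - A k (M k))⁺‖ := fun k => by
    rw [hM]; exact hg _ (hA0 _ _)
  have hMmono : StrictMono M := strictMono_nat_of_lt_succ fun k => by
    by_contra! hlt
    have h1 : w (M (k + 1)) ≤ A k (M k) := by
      refine le_trans ?_ (hwA k (M k) _ hlt)
      exact le_smul_of_one_le_left (hw _) (one_le_pow₀ (by norm_num))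
    have h2 := hMε k
    rw [posPart_eq_zero.2 (sub_nonpos.2 h1), norm_zero] at h2
    linarith
  set x : ℕ → F := fun k => w (M k) with hx
  have hx0 : ∀ k, 0 ≤ x k := fun k => hw _
  have hxA : ∀ j k, j ≤ k → (4 : ℝ) ^ k • x j ≤ A k (M k) := fun j k hjk =>
    hwA _ _ _ (hMmono.monotone hjk)
  have hsum : Summable fun k => ((1 : ℝ) / 2) ^ k • x k := by
    refine Summable.of_norm_bounded (g := fun k => ((1 : ℝ) / 2) ^ k * C)
      (summable_geometric_two.mul_right C) fun k => ?_
    rw [norm_smul, norm_pow, Real.norm_of_nonneg (by norm_num)]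
    exact mul_le_mul_of_nonneg_left (hC _) (by positivity)
  set v := ∑' k, ((1 : ℝ) / 2) ^ k • x k with hv
  have hterm : ∀ k, 0 ≤ ((1 : ℝ) / 2) ^ k • x k := fun k => smul_nonneg (by positivity) (hx0 k)
  have hv0 : 0 ≤ v := tsum_nonneg hterm
  have hxv : ∀ k, ((1 : ℝ) / 2) ^ k • x k ≤ v := fun k => hsum.le_tsum k fun j _ => hterm j
  -- Subtracting the multiple of earlier terms and a small multiple of v, which controls later
  -- terms, makes the positive parts exactly disjoint.
  set p : ℕ → F := fun k => x (k + 1) - A k (M k) - ((1 : ℝ) / 2) ^ k • v with hp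
  have hpv : ∀ k, 0 ≤ ((1 : ℝ) / 2) ^ k • v := fun k => smul_nonneg (by positivity) hv0
  have hple : ∀ k, (p k)⁺ ≤ x (k + 1) := fun k =>
    sup_le ((sub_le_self _ (hpv k)).trans (sub_le_self _ (hA0 _ _))) (hx0 (k + 1))
  have hdis : ∀ j k, j < k → (p j)⁺ ⊓ (p k)⁺ = 0 := by
    intro j k hjk
    -- The positive parts of p k and p j lie below d⁺ and (-d)⁺ respectively.
    set d := x (k + 1) - (4 : ℝ) ^ k • x (j + 1) with hd
    have h1 : p k ≤ d :=
      (sub_le_self _ (hpv k)).trans (sub_le_sub_left (hxA (j + 1) k hjk) _)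
    have h2 : p j ≤ ((1 : ℝ) / 4) ^ k • (-d) := by
      have e : ((1 : ℝ) / 4) ^ k • (-d) = x (j + 1) - ((1 : ℝ) / 4) ^ k • x (k + 1) := by
        rw [hd, neg_sub, smul_sub, smul_smul, ← mul_pow]
        norm_num
      rw [e]
      have h3 : p j ≤ x (j + 1) - ((1 : ℝ) / 2) ^ j • v :=
        sub_le_sub_right (sub_le_self _ (hA0 _ _)) _
      refine h3.trans (sub_le_sub_left ?_ _)
      refine le_trans ?_ (smul_le_smul_of_nonneg_left (hxv (k + 1)) (by positivity))
      rw [smul_smul]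
      refine smul_le_smul_of_nonneg_right ?_ (hx0 (k + 1))
      have : ((1 : ℝ) / 4) ^ k = (1 / 2) ^ (k + k) := by
        rw [← two_mul, pow_mul]; norm_num
      rw [this, ← pow_add]
      exact pow_le_pow_of_le_one (by norm_num) (by norm_num) (by omega)
    have h4 : (p j)⁺ ≤ (-d)⁺ := by
      refine sup_le (h2.trans ?_) (posPart_nonneg _)
      refine (smul_le_smul_of_nonneg_left (le_posPart (-d)) (by positivity)).trans ?_
      exact smul_le_of_le_one_left (posPart_nonneg _) (pow_le_one₀ (by norm_num) (by norm_num))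
    refine le_antisymm ?_ (le_inf (posPart_nonneg _) (posPart_nonneg _))
    rw [← posPart_inf_posPart_neg d, inf_comm]
    exact inf_le_inf (posPart_mono h1) h4
  have hnorm : ∀ k, ε ≤ ‖(p k)⁺‖ + ((1 : ℝ) / 2) ^ k * ‖v‖ := by
    intro k
    refine (hMε k).le.trans ?_
    have h1 : (w (M (k + 1)) - A k (M k))⁺ ≤ (p k)⁺ + ((1 : ℝ) / 2) ^ k • v := by
      refine sup_le ?_ (add_nonneg (posPart_nonneg _) (hpv k))
      rw [← sub_le_iff_le_add]
      exact le_posPart (p k)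
    refine (norm_mono_of_nonneg (posPart_nonneg _) h1).trans ((norm_add_le _ _).trans_eq ?_)
    rw [norm_smul, norm_pow, Real.norm_of_nonneg (by norm_num : (0 : ℝ) ≤ 1 / 2)]
  have hlim : Tendsto (fun k => ((1 : ℝ) / 2) ^ k * ‖v‖) atTop (𝓝 0) := by
    simpa using (tendsto_pow_atTop_nhds_zero_of_lt_one (by norm_num : (0 : ℝ) ≤ 1 / 2)
      (by norm_num)).mul_const ‖v‖
  obtain ⟨K, hK⟩ := eventually_atTop.1 (hlim.eventually (gt_mem_nhds (half_pos hε)))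
  refine ⟨fun k => M (k + K + 1), fun k => (p (k + K))⁺,
    fun i j hij => hMmono (show i + K + 1 < j + K + 1 by omega),
    fun k => posPart_nonneg _, fun k => hple _, fun i j hij => ?_, fun k => ?_⟩
  · rcases lt_or_gt_of_ne hij with h | h
    · exact hdis _ _ (by omega)
    · rw [inf_comm]; exact hdis _ _ (by omega)
  · have := hnorm (k + K)
    have := hK (k + K) (by omega)
    linarith

/-- The abstract form of the uniform integrability of weakly null sequences in L¹. -/
theorem NormAdditiveOnCone.exists_norm_posPart_sub_le (hF : NormAdditiveOnCone F) {b : ℕ → F}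
    {C : ℝ} (hC : ∀ n, ‖b n‖ ≤ C)
    (hb : ∀ φ : F →L[ℝ] ℝ, Tendsto (fun n => φ (b n)) atTop (𝓝 0)) {ε : ℝ} (hε : 0 < ε) :
    ∃ u, 0 ≤ u ∧ ∀ n, ‖((b n)⁺ - u)⁺‖ ≤ ε := by
  by_contra! hcon
  have hC' : ∀ n, ‖(b n)⁺‖ ≤ C := fun n => (norm_le_norm_of_abs_le_abs (by
    rw [abs_of_nonneg (posPart_nonneg (b n))]
    exact sup_le (le_abs_self _) (abs_nonneg _))).trans (hC n)
  obtain ⟨N, z, hN, hz0, hzle, hd, hz⟩ :=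
    exists_disjoint_seq (fun n => posPart_nonneg (b n)) hC' hε hcon
  set a : ℕ → ℕ → ℝ := fun k n => bandNorm (z k) (b (N n))⁺ - bandNorm (z k) (b (N n))⁻ with ha
  have hsum : ∀ y : F, 0 ≤ y → Summable fun k => bandNorm (z k) y := fun y hy =>
    summable_bandNorm hF hz0 hd hy
  have hS : ∀ S : Set ℕ,
      Tendsto (fun n => ∑' k, S.indicator (fun k => a k n) k) atTop (𝓝 0) := by
    intro S
    have hsumS : ∀ y : F, 0 ≤ y → Summable (S.indicator fun k => bandNorm (z k) y) := fun y hy =>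
      (hsum y hy).indicator S
    obtain ⟨φ, hφ⟩ := exists_extend_of_additiveOnCone
      (fun y => ∑' k, S.indicator (fun k => bandNorm (z k) y) k)
      (fun x y hx hy => by
        rw [← (hsumS x hx).tsum_add (hsumS y hy)]
        congr 1; ext k
        simp only [Set.indicator]
        split_ifs
        · exact bandNorm_add hF (hz0 k) hx hy
        · exact (add_zero 0).symm)
      (fun x _ => tsum_nonneg fun k => Set.indicator_nonneg (fun _ _ => bandNorm_nonneg _ _) k)
      (fun x hx => (hsumS x hx).tsum_le_of_sum_le fun s =>
        (Finset.sum_le_sum fun k _ =>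
          Set.indicator_le_self' (fun _ _ => bandNorm_nonneg _ _) k).trans
            (sum_bandNorm_le hF s hz0 hd hx))
    refine ((hb φ).comp hN.tendsto_atTop).congr fun n => ?_
    rw [Function.comp_apply, hφ,
      ← (hsumS _ (posPart_nonneg _)).tsum_sub (hsumS _ (negPart_nonneg _))]
    congr 1; ext k
    simp only [Set.indicator]
    split_ifs
    · rfl
    · exact sub_self 0
  obtain ⟨S, hS'⟩ := exists_set_not_tendsto_tsum (a := a) (half_pos hε)
    (fun n => (hsum _ (posPart_nonneg _)).sub (hsum _ (negPart_nonneg _)))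
    (fun k => (hS {k}).congr fun n => by
      rw [tsum_eq_single k fun j hj => Set.indicator_of_notMem (by simpa using hj) _]
      simp)
    -- No cancellation on the diagonal: z k lies below (b (N k))⁺, hence is disjoint from (b (N
    -- k))⁻.
    (fun k => by
      have h1 : bandNorm (z k) (b (N k))⁻ = 0 := by
        refine bandNorm_eq_zero (hz0 k) (negPart_nonneg _)
          (le_antisymm ?_ (le_inf (hz0 k) (negPart_nonneg _)))
        rw [← posPart_inf_negPart_eq_zero (b (N k))]
        exact inf_le_inf_right _ (hzle k)
      simp only [ha, h1, sub_zero]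
      exact (hz k).trans ((norm_le_bandNorm (hz0 k) (hzle k)).trans (le_abs_self _)))
  exact hS' (hS S)

end AlmostOrderBounded

/-! ### Boundedness and evaluation of null sequences -/

theorem exists_norm_le_of_tendsto_weakly {F : Type*} [NormedAddCommGroup F] [NormedSpace ℝ F]
    {b : ℕ → F} (hb : ∀ φ : F →L[ℝ] ℝ, Tendsto (fun n => φ (b n)) atTop (𝓝 0)) :
    ∃ C, ∀ n, ‖b n‖ ≤ C := by
  obtain ⟨C, hC⟩ := banach_steinhaus (g := fun n => NormedSpace.inclusionInDoubleDual ℝ F (b n))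
    fun φ => by
      obtain ⟨C, hC⟩ := (hb φ).norm.bddAbove_range
      exact ⟨C, fun n => hC ⟨n, rfl⟩⟩
  refine ⟨C, fun n => ?_⟩
  rw [← (NormedSpace.inclusionInDoubleDualLi (E := F) ℝ).norm_map (b n)]
  exact hC n

theorem tendsto_apply_of_tendsto_toWeakSpace {𝕜 Y : Type*} [RCLike 𝕜] [NormedAddCommGroup Y]
    [NormedSpace 𝕜 Y] {y : ℕ → Y} (hy : Tendsto (fun n => toWeakSpace 𝕜 Y (y n)) atTop (𝓝 0))
    (ψ : StrongDual 𝕜 Y) : Tendsto (fun n => ψ (y n)) atTop (𝓝 0) := by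
  have h := ((WeakBilin.eval_continuous (topDualPairing 𝕜 Y).flip ψ).tendsto 0).comp hy
  have e : ψ (0 : Y) = 0 := map_zero ψ
  exact e ▸ h

section Pairing

variable {𝕜 : Type*} [RCLike 𝕜]
  {X : Type*} [NormedAddCommGroup X] [NormedSpace 𝕜 X] [CompleteSpace X]
  {Y : Type*} [NormedAddCommGroup Y] [NormedSpace 𝕜 Y] [CompleteSpace Y]
  {B : X →ₗ[𝕜] Y →ₗ[𝕜] 𝕜}

omit [CompleteSpace X] [CompleteSpace Y] in
theorem TendstoZeroSigma.tendsto_apply {x : ℕ → X} (hx : TendstoZeroSigma B x) (y : Y) :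
    Tendsto (fun n => B (x n) y) atTop (𝓝 0) := by
  have h := ((WeakBilin.eval_continuous B y).tendsto (0 : WeakBilin B)).comp hx
  have e : B (0 : X) y = 0 := by simp
  exact e ▸ h

theorem IsNormingDualPair.norm_apply_le (hB : IsNormingDualPair B) (x : X) (y : Y) :
    ‖B x y‖ ≤ ‖x‖ * ‖y‖ := by
  rcases eq_or_ne y 0 with rfl | hy
  · simp
  have hy' : 0 < ‖y‖ := norm_pos_iff.2 hy
  have h := (hB.norm_left x).1 ⟨((‖y‖⁻¹ : ℝ) : 𝕜) • y, by
    rw [norm_smul, RCLike.norm_ofReal, abs_of_pos (inv_pos.2 hy'), inv_mul_cancel₀ hy'.ne'], rfl⟩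
  rw [map_smul, norm_smul, RCLike.norm_ofReal, abs_of_pos (inv_pos.2 hy'),
    inv_mul_le_iff₀ hy'] at h
  rwa [mul_comm]

/-- Banach–Steinhaus for the functionals ⟨x n, ·⟩ on Y; since Y is norming, their operator norms
bound ‖x n‖. -/
theorem IsNormingDualPair.exists_norm_le (hB : IsNormingDualPair B) {x : ℕ → X}
    (hx : TendstoZeroSigma B x) : ∃ C, ∀ n, ‖x n‖ ≤ C := by
  obtain ⟨C, hC⟩ := banach_steinhaus
    (g := fun n => (B (x n)).mkContinuous ‖x n‖ (hB.norm_apply_le (x n))) fun y => by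
      obtain ⟨C, hC⟩ := (hx.tendsto_apply y).norm.bddAbove_range
      exact ⟨C, fun n => hC ⟨n, rfl⟩⟩
  refine ⟨C, fun n => (hB.norm_left (x n)).2 ?_⟩
  rintro _ ⟨y, hy, rfl⟩
  exact (ContinuousLinearMap.le_opNorm _ y).trans
    ((mul_le_of_le_one_right (norm_nonneg _) hy).trans (hC n))

end Pairing

/-! ### Real and imaginary parts in a Banach lattice over 𝕜 -/

namespace BanachLatticeStructure

variable {𝕜 : Type*} [RCLike 𝕜]
  {E : Type*} [NormedAddCommGroup E] [Lattice E] [HasSolidNorm E] [IsOrderedAddMonoid E]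
  [NormedSpace ℝ E] [IsOrderedModule ℝ E] [CompleteSpace E]
  {X : Type*} [NormedAddCommGroup X] [NormedSpace 𝕜 X] [CompleteSpace X]
  (L : BanachLatticeStructure 𝕜 E X)

theorem re_smul_sub_le_modulus (a b : E) {c : 𝕜} (hc : ‖c‖ = 1) :
    RCLike.re c • a - RCLike.im c • b ≤ L.modulus (L.ofReal a + (RCLike.I : 𝕜) • L.ofReal b) :=
  (L.isLUB_modulus a b).1 ⟨c, hc, rfl⟩

theorem abs_le_modulus (a b : E) :
    |a| ≤ L.modulus (L.ofReal a + (RCLike.I : 𝕜) • L.ofReal b) := by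
  refine sup_le ?_ ?_
  · simpa using L.re_smul_sub_le_modulus a b (c := 1) (by simp)
  · simpa using L.re_smul_sub_le_modulus a b (c := -1) (by simp)

theorem modulus_nonneg (x : X) : 0 ≤ L.modulus x := by
  obtain ⟨a, b, rfl⟩ := L.exists_eq x
  exact (abs_nonneg a).trans (L.abs_le_modulus a b)

theorem norm_ofReal_of_nonneg {a : E} (ha : 0 ≤ a) : ‖L.ofReal a‖ = ‖a‖ := by
  have h : L.modulus (L.ofReal a) = a := by
    have h1 := L.abs_le_modulus a 0
    have h2 := L.isLUB_modulus a 0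
    simp only [map_zero, smul_zero, add_zero, sub_zero] at h1 h2
    refine le_antisymm (h2.2 ?_) ((le_abs_self a).trans h1)
    rintro _ ⟨c, hc, rfl⟩
    exact smul_le_of_le_one_left ha ((RCLike.re_le_norm c).trans hc.le)
  rw [← L.norm_modulus, h]

/-- The real part of an element of a complex Banach lattice. -/
noncomputable def realPart (x : X) : E := (L.exists_eq x).choose

/-- Applied to x = 0 it makes the real part unique; in general it makes taking real parts
contractive. -/
theorem norm_le_of_eq {x : X} {a b : E} (h : x = L.ofReal a + (RCLike.I : 𝕜) • L.ofReal b) :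
    ‖a‖ ≤ ‖x‖ := by
  rw [← L.norm_modulus x, h, ← norm_abs_eq_norm a]
  exact norm_mono_of_nonneg (abs_nonneg a) (L.abs_le_modulus a b)

theorem realPart_eq {x : X} {a b : E} (h : x = L.ofReal a + (RCLike.I : 𝕜) • L.ofReal b) :
    L.realPart x = a := by
  obtain ⟨b', hb'⟩ := (L.exists_eq x).choose_spec
  change x = L.ofReal (L.realPart x) + _ at hb'
  have h0 : (0 : X) = L.ofReal (L.realPart x - a) + (RCLike.I : 𝕜) • L.ofReal (b' - b) := by
    rw [map_sub, map_sub, smul_sub, sub_add_sub_comm, ← hb', ← h, sub_self]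
  have := L.norm_le_of_eq h0
  rwa [norm_zero, norm_le_zero_iff, sub_eq_zero] at this

theorem norm_realPart_le (x : X) : ‖L.realPart x‖ ≤ ‖x‖ := by
  obtain ⟨b, hb⟩ := (L.exists_eq x).choose_spec
  exact L.norm_le_of_eq hb

theorem realPart_add (x y : X) : L.realPart (x + y) = L.realPart x + L.realPart y := by
  obtain ⟨a, b, hx⟩ := L.exists_eq x
  obtain ⟨c, d, hy⟩ := L.exists_eq y
  rw [L.realPart_eq hx, L.realPart_eq hy]
  refine L.realPart_eq (b := b + d) ?_
  rw [map_add, map_add, smul_add, hx, hy, add_add_add_comm]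

theorem eq_realPart_add (x : X) : x = L.ofReal (L.realPart x) +
    (RCLike.I : 𝕜) • L.ofReal (L.realPart (-(RCLike.I : 𝕜) • x)) := by
  obtain ⟨a, b, h⟩ := L.exists_eq x
  rw [L.realPart_eq h]
  -- Either I = 0 (real scalars), where the second term vanishes, or I * I = -1.
  rcases RCLike.I_mul_I_ax (K := 𝕜) with hI | hI
  · rw [hI] at h ⊢
    simpa using h
  · have : L.realPart (-(RCLike.I : 𝕜) • x) = b := by
      refine L.realPart_eq (b := -a) ?_
      rw [h, smul_add, smul_smul, neg_mul, hI, neg_neg, one_smul, map_neg, smul_neg, neg_smul,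
        add_comm]
    rw [this, h]

/-- Composing a functional with the real part gives the real part of a functional, so that weakly
null sequences have weakly null real parts. -/
theorem tendsto_apply_realPart {x : ℕ → X}
    (hx : Tendsto (fun n => toWeakSpace 𝕜 X (x n)) atTop (𝓝 0)) (φ : E →L[ℝ] ℝ) :
    Tendsto (fun n => φ (L.realPart (x n))) atTop (𝓝 0) := by
  let _ : NormedSpace ℝ X := NormedSpace.restrictScalars ℝ 𝕜 X
  have _ : IsScalarTower ℝ 𝕜 X := RestrictScalars.isScalarTower ℝ 𝕜 X
  let R : X →+ E := AddMonoidHom.mk' L.realPart L.realPart_add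
  have hR : Continuous R := AddMonoidHomClass.continuous_of_bound R 1 fun x => by
    rw [one_mul]; exact L.norm_realPart_le x
  obtain ⟨ψ, hψ⟩ : ∃ ψ : StrongDual 𝕜 X, ∀ x, RCLike.re (ψ x) = φ (L.realPart x) :=
    ⟨StrongDual.extendRCLike (φ.comp (R.toRealLinearMap hR)),
      fun x => StrongDual.re_extendRCLike_apply _ x⟩
  have h1 := tendsto_apply_of_tendsto_toWeakSpace hx ψ
  have h2 := (RCLike.continuous_re.tendsto (0 : 𝕜)).comp h1
  rw [map_zero] at h2
  exact h2.congr fun n => hψ (x n)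

end BanachLatticeStructure

/-! ### Positive pairings and the main estimate -/

section LatticePairing

variable {𝕜 : Type*} [RCLike 𝕜]
  {E : Type*} [NormedAddCommGroup E] [Lattice E] [HasSolidNorm E] [IsOrderedAddMonoid E]
  [NormedSpace ℝ E] [IsOrderedModule ℝ E] [CompleteSpace E]
  {X : Type*} [NormedAddCommGroup X] [NormedSpace 𝕜 X] [CompleteSpace X]
  {F : Type*} [NormedAddCommGroup F] [Lattice F] [HasSolidNorm F] [IsOrderedAddMonoid F]
  [NormedSpace ℝ F] [IsOrderedModule ℝ F] [CompleteSpace F]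
  {Y : Type*} [NormedAddCommGroup Y] [NormedSpace 𝕜 Y] [CompleteSpace Y]
  {L : BanachLatticeStructure 𝕜 E X} {M : BanachLatticeStructure 𝕜 F Y}
  {B : X →ₗ[𝕜] Y →ₗ[𝕜] 𝕜}

namespace IsPositivePairing

theorem im_eq_zero (hpos : IsPositivePairing L M B) (a : E) {b : F} (hb : 0 ≤ b) :
    RCLike.im (B (L.ofReal a) (M.ofReal b)) = 0 := by
  obtain ⟨r, -, hr⟩ := hpos a⁺ b (posPart_nonneg a) hb
  obtain ⟨s, -, hs⟩ := hpos a⁻ b (negPart_nonneg a) hb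
  rw [← posPart_sub_negPart a, map_sub, map_sub, LinearMap.sub_apply, hr, hs]
  simp

theorem re_mono (hpos : IsPositivePairing L M B) {a a' : E} (h : a ≤ a') {b : F} (hb : 0 ≤ b) :
    RCLike.re (B (L.ofReal a) (M.ofReal b)) ≤ RCLike.re (B (L.ofReal a') (M.ofReal b)) := by
  obtain ⟨r, hr0, hr⟩ := hpos (a' - a) b (sub_nonneg.2 h) hb
  rw [map_sub, map_sub, LinearMap.sub_apply] at hr
  have := congrArg RCLike.re hr
  rw [map_sub, RCLike.ofReal_re] at this
  linarith

/-- A unimodular c rotates ⟨x, b⟩ onto its absolute value, and the real part of c x lies below the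
modulus of x. -/
theorem norm_apply_le (hpos : IsPositivePairing L M B) (x : X) {b : F} (hb : 0 ≤ b) :
    ‖B x (M.ofReal b)‖ ≤ RCLike.re (B (L.ofReal (L.modulus x)) (M.ofReal b)) := by
  obtain ⟨p, q, hx⟩ := L.exists_eq x
  obtain ⟨c, hc, hcB⟩ := RCLike.exists_norm_eq_mul_self (B x (M.ofReal b))
  have h := hpos.re_mono (L.re_smul_sub_le_modulus p q hc) hb
  rw [← hx] at h
  refine le_trans (le_of_eq ?_) h
  have hp := hpos.im_eq_zero p hb
  have hq := hpos.im_eq_zero q hb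
  rw [← RCLike.ofReal_re (K := 𝕜) ‖B x (M.ofReal b)‖, hcB, hx]
  simp only [map_add, map_sub, map_smulₛₗ, LinearMap.add_apply, LinearMap.sub_apply,
    LinearMap.smul_apply, smul_eq_mul, RingHom.id_apply, RCLike.mul_re, RCLike.mul_im, hp, hq,
    RCLike.I_re, RCLike.algebraMap_eq_ofReal, RCLike.ofReal_re, RCLike.ofReal_im]
  linear_combination (-RCLike.re (B (L.ofReal q) (M.ofReal b))) * RCLike.mul_im_I_ax c

theorem re_mono_right (hpos : IsPositivePairing L M B) {a : E} (ha : 0 ≤ a) {b b' : F}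
    (h : b ≤ b') :
    RCLike.re (B (L.ofReal a) (M.ofReal b)) ≤ RCLike.re (B (L.ofReal a) (M.ofReal b')) := by
  obtain ⟨r, hr0, hr⟩ := hpos a (b' - b) ha (sub_nonneg.2 h)
  rw [map_sub, map_sub] at hr
  have := congrArg RCLike.re hr
  rw [map_sub, RCLike.ofReal_re] at this
  linarith

/-- Pairing a `σ(X, Y)`-null sequence with the positive parts of a weakly null sequence of an
AL-space. -/
theorem tendsto_apply_ofReal_posPart (hpos : IsPositivePairing L M B) (hB : IsNormingDualPair B)
    (hX : SeqSigmaContinuousLatticeOps L B) (hY : NormAdditiveOnCone F) {x : ℕ → X} {b : ℕ → F}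
    (hx : TendstoZeroSigma B x)
    (hb : ∀ φ : F →L[ℝ] ℝ, Tendsto (fun n => φ (b n)) atTop (𝓝 0)) :
    Tendsto (fun n => B (x n) (M.ofReal (b n)⁺)) atTop (𝓝 0) := by
  obtain ⟨C, hC⟩ := hB.exists_norm_le hx
  obtain ⟨D, hD⟩ := exists_norm_le_of_tendsto_weakly hb
  have hC0 : 0 ≤ C := (norm_nonneg _).trans (hC 0)
  rw [NormedAddCommGroup.tendsto_atTop]
  intro ε hε
  -- C + 1 replaces C to avoid division by zero.
  obtain ⟨u, hu0, hu⟩ := hY.exists_norm_posPart_sub_le hD hb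
    (show 0 < ε / (2 * (C + 1)) by positivity)
  obtain ⟨N, hN⟩ := NormedAddCommGroup.tendsto_atTop.1
    ((hX x hx).tendsto_apply (M.ofReal u)) _ (half_pos hε)
  refine ⟨N, fun n hn => ?_⟩
  have h1 := hN n hn
  rw [sub_zero] at h1 ⊢
  have hle : (b n)⁺ ≤ u + ((b n)⁺ - u)⁺ := by
    rw [← sub_le_iff_le_add']
    exact le_posPart _
  have h2 := (hpos.norm_apply_le (x n) (posPart_nonneg (b n))).trans
    (hpos.re_mono_right (L.modulus_nonneg (x n)) hle)
  rw [map_add, map_add, map_add] at h2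
  have h3 := RCLike.re_le_norm (B (L.ofReal (L.modulus (x n))) (M.ofReal u))
  have h4 := (RCLike.re_le_norm (B (L.ofReal (L.modulus (x n))) (M.ofReal ((b n)⁺ - u)⁺))).trans
    (hB.norm_apply_le _ _)
  rw [L.norm_ofReal_of_nonneg (L.modulus_nonneg _), M.norm_ofReal_of_nonneg (posPart_nonneg _),
    L.norm_modulus] at h4
  have h5 : ‖x n‖ * ‖((b n)⁺ - u)⁺‖ ≤ (C + 1) * (ε / (2 * (C + 1))) :=
    mul_le_mul ((hC n).trans (by linarith)) (hu n) (norm_nonneg _) (by linarith)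
  have h6 : (C + 1) * (ε / (2 * (C + 1))) = ε / 2 := by field_simp
  linarith

theorem tendsto_apply_ofReal (hpos : IsPositivePairing L M B) (hB : IsNormingDualPair B)
    (hX : SeqSigmaContinuousLatticeOps L B) (hY : NormAdditiveOnCone F) {x : ℕ → X} {b : ℕ → F}
    (hx : TendstoZeroSigma B x)
    (hb : ∀ φ : F →L[ℝ] ℝ, Tendsto (fun n => φ (b n)) atTop (𝓝 0)) :
    Tendsto (fun n => B (x n) (M.ofReal (b n))) atTop (𝓝 0) := by
  have h1 := hpos.tendsto_apply_ofReal_posPart hB hX hY hx hb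
  -- Negative parts are positive parts of the weakly null sequence -b.
  have h2 := hpos.tendsto_apply_ofReal_posPart hB hX hY hx (b := fun n => -b n) fun φ => by
    simpa using (hb φ).neg
  have h3 := h1.sub h2
  rw [sub_zero] at h3
  refine h3.congr fun n => ?_
  rw [posPart_neg, ← map_sub, ← map_sub, posPart_sub_negPart]

end IsPositivePairing

end LatticePairing

theorem propositionp {𝕜 : Type*} [RCLike 𝕜]
    {E : Type*} [NormedAddCommGroup E] [Lattice E] [HasSolidNorm E] [IsOrderedAddMonoid E]
    [NormedSpace ℝ E] [IsOrderedModule ℝ E] [CompleteSpace E]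
    {X : Type*} [NormedAddCommGroup X] [NormedSpace 𝕜 X] [CompleteSpace X]
    {F : Type*} [NormedAddCommGroup F] [Lattice F] [HasSolidNorm F] [IsOrderedAddMonoid F]
    [NormedSpace ℝ F] [IsOrderedModule ℝ F] [CompleteSpace F]
    {Y : Type*} [NormedAddCommGroup Y] [NormedSpace 𝕜 Y] [CompleteSpace Y]
    (L : BanachLatticeStructure 𝕜 E X) (M : BanachLatticeStructure 𝕜 F Y)
    (B : X →ₗ[𝕜] Y →ₗ[𝕜] 𝕜) (hB : IsNormingDualPair B) (hpos : IsPositivePairing L M B)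
    (hX : SeqSigmaContinuousLatticeOps L B) (hY : NormAdditiveOnCone F) :
    HasDunfordPettisProperty B := by
  intro x y hx hy
  -- The real part of -i y n serves as the imaginary part of y n.
  have hIy : Tendsto (fun n => toWeakSpace 𝕜 Y (-(RCLike.I : 𝕜) • y n)) atTop (𝓝 0) := by
    have h := hy.const_smul (-(RCLike.I : 𝕜))
    rw [smul_zero] at h
    exact h.congr fun n => (map_smul _ _ _).symm
  have h1 := hpos.tendsto_apply_ofReal hB hX hY hx (M.tendsto_apply_realPart hy)
  have h2 := hpos.tendsto_apply_ofReal hB hX hY hx (M.tendsto_apply_realPart hIy)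
  have h3 := h1.add (h2.const_mul (RCLike.I : 𝕜))
  rw [mul_zero, add_zero] at h3
  refine h3.congr fun n => ?_
  conv_rhs => rw [M.eq_realPart_add (y n)]
  rw [map_add, map_smul, smul_eq_mul]
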